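/- There is an absolute constant $C>0$ such that the following holds. Let $m\ge 1$ be an integer with exactly $d$ prime factors counted with multiplicity, let $n\ge 0$, and let $f\in\mathbb Z_m[x_1,\dots,x_n]$ be a quadratic polynomial (that is, of total degree at most $2$), where $\mathbb Z_m=\mathbb Z/m\mathbb Z$. Let $\mathrm{OR}_n:\{0,1\}^n\to\{0,1\}$ be the function with $\mathrm{OR}_n(\mathbf 0)=0$ and $\mathrm{OR}_n(\mathbf x)=1$ for $\mathbf x\ne\mathbf 0$. Suppose that $f$ weakly represents $\mathrm{OR}_n$ modulo $m$, that is, there is a set $A\subseteq\mathbb Z_m$ such that for all $\mathbf x\in\{0,1\}^n$, \[ \mathrm{OR}_n(\mathbf x)=0\iff f(\mathbf x)\in A,\qquad \mathrm{OR}_n(\mathbf x)=1\iff f(\mathbf x)\in \mathbb Z_m\setminus A . \] Then \[ n\le m^{Cd}\le m^{C\log_2 m}. \] -/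

import Mathlib

/-- The function `OR_n : {0,1}^n → {0,1}`, equal to `0` at the zero vector and to `1` at every
other vector. The Boolean cube is `Fin n → Bool`, with `false = 0` and `true = 1`. -/
def orFn (n : ℕ) (x : Fin n → Bool) : Bool :=
  decide (x ≠ fun _ => false)

/-- `f : {0,1}^n → ℤ/m` weakly represents `g : {0,1}^n → {0,1}`: there is a partition
`ℤ/m = A ∪ Aᶜ` with `g x = 0 ↔ f x ∈ A` and `g x = 1 ↔ f x ∈ Aᶜ` on the whole cube. -/
def WeaklyRepresents {n m : ℕ} (f : (Fin n → Bool) → ZMod m) (g : (Fin n → Bool) → Bool) : Prop :=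
  ∃ A : Set (ZMod m), ∀ x, (g x = false ↔ f x ∈ A) ∧ (g x = true ↔ f x ∈ Aᶜ)

/-- The function `{0,1}^n → ℤ/m` given by evaluating a polynomial at points of the Boolean cube. -/
noncomputable def boolEval {n m : ℕ} (f : MvPolynomial (Fin n) (ZMod m)) (x : Fin n → Bool) :
    ZMod m :=
  MvPolynomial.eval (fun i => if x i = true then (1 : ZMod m) else 0) f

/-!
Identify a point of the Boolean cube with the set `S` of its coordinates equal to `1`, and let `F S`
be an integer lift of `f S - f ∅`. Weak representation of `OR` says exactly that `m ∤ F S` for every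
nonempty `S`, while `deg f ≤ 2` says that third differences of `F` on disjoint sets vanish modulo
`m`. The polar form `F (S ∪ T) - F S - F T` is therefore additive modulo `m` in each argument. The
claim is that such an `F` has a nonempty `S` with `m ∣ F S` as soon as `n ≥ m ^ (6 * d)`.

The proof is an induction on the number `d` of prime factors. Consider a family `𝒮` of nonempty sets
at which `F` takes distinct nonzero values modulo `m`. The set `A ⊆ ℤ/m` of these values omits `0`,
so its translation stabilizer is a proper subgroup, contained in `p ℤ/m` for some prime `p ∣ m`
(`exists_prime_dvd_of_stabilizes`). Outside the coordinates used by `𝒮`, choose many disjoint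
nonempty blocks that are orthogonal to every member of `𝒮` for the polar form
(`IsQuadraticMod.exists_orthogonal_blocks`). There are two possibilities.

* Some `W`, a block or a union of two blocks, has `p ∤ F W`. Translation by `F W` then moves `A`, and
  `F (S ∪ W) ≡ F S + F W` for `S ∈ 𝒮`, so some `S ∪ W` has a value outside `A` and `𝒮` can be
  enlarged (`IsQuadraticMod.exists_larger_family`). This happens fewer than `m` times.
* Otherwise `p` divides `F` at all blocks and at all unions of two blocks. As `F` is quadratic, `p`
  divides `F` at every union of blocks, and `F / p`, as a function of the set of blocks used, is a
  quadratic function modulo `m / p`, to which induction applies.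

A block is a solution of at most `m` linear equations modulo `m`, that is, a zero-sum subsequence in
a group of exponent `m` and order at most `m ^ m`. The bound on the Davenport constant by
`m * log |G| + 1`, due to van Emde Boas–Kruyswijk and Meshulam (`exists_nonempty_sum_eq_zero`),
gives one inside any `m ^ 3` coordinates, so each step of the induction loses only a factor
polynomial in `m`.
-/

/-! ### Zero-sum subsequences in groups of exponent `m` -/

/-- Greedy choice: `α i` is the most popular value of `χ (g i)` among the characters `χ` not matched
so far. These values are `m`-th roots of unity, so each step matches at least a fraction `1 / m` of
the remaining characters. -/
theorem exists_killing_constants {G : Type*} [AddCommGroup G] [Finite G] {m : ℕ} (hm : 0 < m)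
    (hG : ∀ x : G, m • x = 0) {l : ℕ} (g : Fin l → G) (X : Finset (AddChar G ℂ))
    (hX : X.card * (m - 1) ^ l < m ^ l) :
    ∃ α : Fin l → ℂ, (∀ i, α i ≠ 0) ∧ ∀ χ ∈ X, ∃ i, α i = χ (g i) := by
  classical
  induction l generalizing X with
  | zero =>
    refine ⟨0, fun i => i.elim0, fun χ hχ => ?_⟩
    have : X.card = 0 := by simpa using hX
    simp_all
  | succ l ih =>
    have hroot : ∀ χ ∈ X, χ (g 0) ∈ Polynomial.nthRootsFinset m (1 : ℂ) := by
      intro χ _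
      rw [Polynomial.mem_nthRootsFinset hm, ← AddChar.map_nsmul_eq_pow, hG, AddChar.map_zero_eq_one]
    have hcard : (Polynomial.nthRootsFinset m (1 : ℂ)).card ≤ m := by
      rw [(Complex.isPrimitiveRoot_exp m hm.ne').card_nthRootsFinset]
    have h1 : (1 : ℂ) ∈ Polynomial.nthRootsFinset m (1 : ℂ) := by
      simp [Polynomial.mem_nthRootsFinset hm]
    obtain ⟨a, ha, hfib⟩ := Finset.exists_max_image (Polynomial.nthRootsFinset m (1 : ℂ))
      (fun a => (X.filter fun χ => χ (g 0) = a).card) ⟨1, h1⟩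
    have hbig : X.card ≤ m * (X.filter fun χ => χ (g 0) = a).card := by
      rw [Finset.card_eq_sum_card_fiberwise hroot]
      refine (Finset.sum_le_card_nsmul _ _ _ hfib).trans ?_
      rw [smul_eq_mul]
      gcongr
    have hsplit := Finset.card_filter_add_card_filter_not (s := X) (fun χ => χ (g 0) = a)
    have hrest : m * (X.filter fun χ => ¬ χ (g 0) = a).card ≤ X.card * (m - 1) := by
      obtain ⟨k, rfl⟩ : ∃ k, m = k + 1 := ⟨m - 1, by omega⟩
      simp only [Nat.add_sub_cancel]
      nlinarith
    have hlt : (X.filter fun χ => ¬ χ (g 0) = a).card * (m - 1) ^ l < m ^ l := by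
      refine Nat.lt_of_mul_lt_mul_left (a := m) ?_
      calc m * ((X.filter fun χ => ¬ χ (g 0) = a).card * (m - 1) ^ l)
          = m * (X.filter fun χ => ¬ χ (g 0) = a).card * (m - 1) ^ l := by ring
        _ ≤ X.card * (m - 1) * (m - 1) ^ l := by gcongr
        _ = X.card * (m - 1) ^ (l + 1) := by ring
        _ < m ^ (l + 1) := hX
        _ = m * m ^ l := by ring
    obtain ⟨α, hα, hkill⟩ := ih (fun i => g i.succ) _ hlt
    refine ⟨Fin.cons a α, ?_, fun χ hχ => ?_⟩
    · refine Fin.cases ?_ (by simpa using hα)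
      rintro rfl
      rw [Polynomial.mem_nthRootsFinset hm] at ha
      simp [hm.ne'] at ha
    · by_cases h : χ (g 0) = a
      · exact ⟨0, by simp [h]⟩
      · obtain ⟨i, hi⟩ := hkill χ (by simp [hχ, h])
        exact ⟨i.succ, by simpa using hi⟩

/-- The hypothesis reads `|G| * (1 - 1 / m) ^ l < 1`. In the group algebra, the product of the
elements `α i - g i` is zero because every character kills it, whereas without nonempty zero-sum
subsequences its coefficient at `0` would be `∏ i, α i ≠ 0`. The proof computes this coefficient by
summing over the characters. -/
theorem exists_nonempty_sum_eq_zero {G : Type*} [AddCommGroup G] [Finite G] {m : ℕ}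
    (hm : 0 < m) (hG : ∀ x : G, m • x = 0) {l : ℕ} (hl : Nat.card G * (m - 1) ^ l < m ^ l)
    (g : Fin l → G) : ∃ T : Finset (Fin l), T.Nonempty ∧ ∑ i ∈ T, g i = 0 := by
  classical
  have := Fintype.ofFinite G
  by_contra! hno
  obtain ⟨α, hα, hkill⟩ := exists_killing_constants hm hG g (Finset.univ : Finset (AddChar G ℂ))
    (by rwa [Finset.card_univ, AddChar.card_eq, ← Nat.card_eq_fintype_card])
  have hzero : ∑ χ : AddChar G ℂ, ∏ i, (-χ (g i) + α i) = 0 := by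
    refine Finset.sum_eq_zero fun χ _ => ?_
    obtain ⟨i, hi⟩ := hkill χ (Finset.mem_univ _)
    exact Finset.prod_eq_zero (Finset.mem_univ i) (by rw [hi]; ring)
  have hterm : ∀ T : Finset (Fin l),
      ∑ χ : AddChar G ℂ, (∏ i ∈ T, -χ (g i)) * ∏ i ∈ Finset.univ \ T, α i =
        if T = ∅ then (Fintype.card G : ℂ) * ∏ i, α i else 0 := by
    intro T
    have : ∀ χ : AddChar G ℂ, (∏ i ∈ T, -χ (g i)) * ∏ i ∈ Finset.univ \ T, α i =
        χ (∑ i ∈ T, g i) * ((-1) ^ T.card * ∏ i ∈ Finset.univ \ T, α i) := by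
      intro χ
      have hsum : χ (∑ i ∈ T, g i) = ∏ i ∈ T, χ (g i) := by
        exact map_prod χ.toMonoidHom (fun i => Multiplicative.ofAdd (g i)) T
      rw [hsum, Finset.prod_neg]
      ring
    rw [Finset.sum_congr rfl fun χ _ => this χ, ← Finset.sum_mul, AddChar.sum_apply_eq_ite]
    by_cases hT : T = ∅
    · subst hT; simp
    · rw [if_neg (hno T (Finset.nonempty_iff_ne_empty.2 hT)), if_neg hT, zero_mul]
  simp_rw [Finset.prod_add, Finset.powerset_univ] at hzero
  rw [Finset.sum_comm, Finset.sum_congr rfl fun T _ => hterm T] at hzero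
  simp only [Finset.sum_ite_eq', Finset.mem_univ, if_true] at hzero
  exact mul_ne_zero (Nat.cast_ne_zero.2 Fintype.card_ne_zero)
    (Finset.prod_ne_zero_iff.2 fun i _ => hα i) hzero

/-- A sequence of length `m ^ 3` is long enough for `exists_nonempty_sum_eq_zero` to apply to
`(ℤ/m) ^ k`, for `k ≤ m`. -/
theorem pow_mul_pred_pow_lt {m k : ℕ} (hm : 2 ≤ m) (hk : k ≤ m) :
    m ^ k * (m - 1) ^ m ^ 3 < m ^ m ^ 3 := by
  obtain ⟨q, rfl⟩ : ∃ q, m = q + 1 := ⟨m - 1, by omega⟩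
  simp only [Nat.add_sub_cancel]
  have hq : 0 < q := by omega
  -- Bernoulli's inequality, in the form `(1 + 1 / q) ^ (q + 1) ≥ 2`.
  have hber : 2 * q ^ (q + 1) ≤ (q + 1) ^ (q + 1) := by
    have := pow_add_mul_le_add_pow (a := q) (b := 1) (by omega) (by omega) (q + 1)
    simp only [Nat.add_sub_cancel, Nat.cast_id, mul_one] at this
    refine le_trans ?_ this
    rw [two_mul, pow_succ' q q]
    gcongr
    omega
  calc (q + 1) ^ k * q ^ (q + 1) ^ 3 ≤ (q + 1) ^ (q + 1) * q ^ (q + 1) ^ 3 := by gcongr; omega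
    _ < (2 ^ (q + 1)) ^ (q + 1) * q ^ (q + 1) ^ 3 := by
        gcongr
        exact Nat.lt_two_pow_self
    _ = (2 * q ^ (q + 1)) ^ (q + 1) ^ 2 := by
        rw [mul_pow, ← pow_mul, ← pow_mul]; ring_nf
    _ ≤ ((q + 1) ^ (q + 1)) ^ (q + 1) ^ 2 := by gcongr
    _ = (q + 1) ^ (q + 1) ^ 3 := by rw [← pow_mul]; ring_nf

/-! ### Sets of residues and their translation stabilizers -/

/-- The integers whose translation preserves `A` form a proper subgroup of `ℤ` containing `m`, since
`A` is nonempty and omits `0`. Such a subgroup lies in `p ℤ` for a prime `p ∣ m`. -/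
theorem exists_prime_dvd_of_stabilizes {m : ℕ} [NeZero m] {A : Finset (ZMod m)}
    (hA : A.Nonempty) (h0 : (0 : ZMod m) ∉ A) :
    ∃ p : ℕ, p.Prime ∧ p ∣ m ∧ ∀ c : ℤ, (∀ a ∈ A, a + (c : ZMod m) ∈ A) → (p : ℤ) ∣ c := by
  classical
  let H : AddSubgroup ℤ :=
    { carrier := {c | ∀ a ∈ A, a + (c : ZMod m) ∈ A}
      zero_mem' := by simp
      add_mem' := by
        intro x y hx hy a ha
        have := hy _ (hx a ha)
        push_cast
        rwa [← add_assoc]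
      neg_mem' := by
        intro c hc a ha
        -- Translation by `c` is an injective self-map of the finite set `A`, hence surjective.
        have hmap : Set.MapsTo (fun a => a + (c : ZMod m)) (A : Set (ZMod m)) A := hc
        have hsurj := Finset.surjOn_of_injOn_of_card_le _ hmap
          (fun x _ y _ h => add_right_cancel h) le_rfl
        obtain ⟨b, hb, hba⟩ := hsurj ha
        have : a + ((-c : ℤ) : ZMod m) = b := by rw [← hba]; push_cast; ring
        rwa [this] }
  obtain ⟨q, hq⟩ := Int.subgroup_cyclic H
  have hmem : ∀ c : ℤ, c ∈ H ↔ q ∣ c := by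
    intro c
    rw [hq, ← AddSubgroup.zmultiples_eq_closure, Int.mem_zmultiples_iff]
  have hqm : q.natAbs ∣ m := by
    rw [← Int.natCast_dvd_natCast, Int.natAbs_dvd, ← hmem]
    intro a ha
    simpa using ha
  have hq1 : q.natAbs ≠ 1 := by
    intro h
    obtain ⟨a, ha⟩ := hA
    have : (-(a.val : ℤ)) ∈ H := by
      rw [hmem, ← Int.natAbs_dvd, h]; simp
    have := this a ha
    simp at this
    exact h0 this
  refine ⟨q.natAbs.minFac, Nat.minFac_prime hq1, (Nat.minFac_dvd _).trans hqm, fun c hc => ?_⟩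
  have : q ∣ c := (hmem c).1 hc
  exact (Int.natCast_dvd.2 (Nat.minFac_dvd _)).trans this

/-! ### Quadratic functions on the Boolean cube -/

/-- `F`, an integer-valued function on the Boolean cube (whose points are given as subsets of
`Fin n`), is modulo `m` a polynomial of degree at most `2` without constant term: its third
differences along disjoint sets vanish modulo `m`. Integer values make it possible to divide `F`
by a prime factor of `m`; vanishing at `∅` is exact, so that it survives this division. -/
structure IsQuadraticMod (m : ℕ) {n : ℕ} (F : Finset (Fin n) → ℤ) : Prop where
  map_empty : F ∅ = 0
  dvd_third_difference : ∀ R S T : Finset (Fin n), Disjoint R S → Disjoint R T → Disjoint S T →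
    (m : ℤ) ∣ F (R ∪ S ∪ T) - F (R ∪ S) - F (R ∪ T) - F (S ∪ T) + F R + F S + F T

theorem disjoint_biUnion_of_pairwise {n N : ℕ} {w : Fin N → Finset (Fin n)}
    (hw : Pairwise fun i j => Disjoint (w i) (w j)) {S T : Finset (Fin N)} (h : Disjoint S T) :
    Disjoint (S.biUnion w) (T.biUnion w) := by
  simp only [Finset.disjoint_biUnion_left, Finset.disjoint_biUnion_right]
  intro i hi j hj
  exact hw fun hij => Finset.disjoint_left.1 h hj (hij ▸ hi)

namespace IsQuadraticMod

variable {m n : ℕ} {F : Finset (Fin n) → ℤ}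

theorem of_dvd {p : ℕ} (hF : IsQuadraticMod m F) (hp : p ∣ m) : IsQuadraticMod p F :=
  ⟨hF.map_empty, fun R S T h₁ h₂ h₃ =>
    (Int.natCast_dvd_natCast.2 hp).trans (hF.dvd_third_difference R S T h₁ h₂ h₃)⟩

/-- Restriction of `F` to the cube spanned by disjoint blocks `w i`. -/
theorem comp_biUnion (hF : IsQuadraticMod m F) {N : ℕ} {w : Fin N → Finset (Fin n)}
    (hw : Pairwise fun i j => Disjoint (w i) (w j)) :
    IsQuadraticMod m fun T => F (T.biUnion w) := by
  refine ⟨by simpa using hF.map_empty, fun R S T h₁ h₂ h₃ => ?_⟩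
  simp only [Finset.union_biUnion]
  exact hF.dvd_third_difference _ _ _ (disjoint_biUnion_of_pairwise hw h₁)
    (disjoint_biUnion_of_pairwise hw h₂) (disjoint_biUnion_of_pairwise hw h₃)

theorem of_mul {p : ℕ} (hp : 0 < p) (hF : IsQuadraticMod (p * m) fun T => p * F T) :
    IsQuadraticMod m F := by
  have hp' : (p : ℤ) ≠ 0 := by exact_mod_cast hp.ne'
  refine ⟨by by_contra h; simpa [hp.ne', h] using hF.map_empty, fun R S T h₁ h₂ h₃ => ?_⟩
  have := hF.dvd_third_difference R S T h₁ h₂ h₃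
  push_cast at this
  rw [← mul_dvd_mul_iff_left hp']
  refine this.trans (dvd_of_eq ?_)
  ring

/-- A quadratic function vanishes modulo `m` as soon as it does so at sets of at most two elements:
its coefficients are determined by these values. -/
theorem dvd_of_card_le_two (hF : IsQuadraticMod m F)
    (h : ∀ S : Finset (Fin n), S.card ≤ 2 → (m : ℤ) ∣ F S) (T : Finset (Fin n)) :
    (m : ℤ) ∣ F T := by
  induction T using Finset.strongInduction with
  | H T ih =>
    by_cases hT : T.card ≤ 2
    · exact h T hT
    obtain ⟨i, j, hi, hj, hij⟩ := Finset.one_lt_card_iff.1 (show 1 < T.card by omega)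
    have hjR : j ∈ T.erase i := Finset.mem_erase.2 ⟨hij.symm, hj⟩
    set R := (T.erase i).erase j with hR
    have hiR : i ∉ R := by simp [hR]
    have hjR' : j ∉ R := by simp [hR]
    have hTR : {i} ∪ {j} ∪ R = T := by
      rw [Finset.union_assoc, ← Finset.insert_eq, ← Finset.insert_eq, hR, Finset.insert_erase hjR,
        Finset.insert_erase hi]
    have hthird := hF.dvd_third_difference {i} {j} R (by simpa using hij) (by simpa using hiR)
      (by simpa using hjR')
    rw [hTR] at hthird
    have hiT : {i} ∪ R ⊂ T := by
      refine Finset.ssubset_iff_subset_ne.2 ⟨by grind, fun h => ?_⟩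
      grind
    have hjT : {j} ∪ R ⊂ T := by
      refine Finset.ssubset_iff_subset_ne.2 ⟨by grind, fun h => ?_⟩
      grind
    have hRT : R ⊂ T := by
      refine Finset.ssubset_iff_subset_ne.2 ⟨by grind, fun h => ?_⟩
      grind
    have e₁ := h ({i} ∪ {j}) (by grind)
    have e₂ := ih _ hiT
    have e₃ := ih _ hjT
    have e₄ := h {i} (by simp)
    have e₅ := h {j} (by simp)
    have e₆ := ih _ hRT
    have := ((((hthird.add e₁).add e₂).add e₃).sub e₄ |>.sub e₅).sub e₆
    refine this.trans (dvd_of_eq ?_)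
    ring

/-- The polar form of `F` is additive modulo `m` in its second argument. -/
theorem dvd_polar_of_sum (hF : IsQuadraticMod m F) (S W : Finset (Fin n)) (hSW : Disjoint W S)
    (h : (m : ℤ) ∣ ∑ i ∈ W, (F (S ∪ {i}) - F S - F {i})) :
    (m : ℤ) ∣ F (S ∪ W) - F S - F W := by
  have key : (m : ℤ) ∣ F (S ∪ W) - F S - F W - ∑ i ∈ W, (F (S ∪ {i}) - F S - F {i}) := by
    clear h
    induction W using Finset.induction_on with
    | empty => simp [hF.map_empty]
    | insert i W hi ih =>
      rw [Finset.disjoint_insert_left] at hSW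
      have h3 := hF.dvd_third_difference S {i} W (by simpa using hSW.1) hSW.2.symm
        (by simpa using hi)
      have := h3.add (ih hSW.2)
      rw [Finset.sum_insert hi, Finset.insert_eq, ← Finset.union_assoc]
      refine this.trans (dvd_of_eq ?_)
      ring
  simpa using key.add h

end IsQuadraticMod

/-! ### Zeros of quadratic functions -/

namespace IsQuadraticMod

variable {m n : ℕ} {F : Finset (Fin n) → ℤ}

/-- There are `N` disjoint nonempty blocks of size at most `m ^ 3` outside `U`, each orthogonal
modulo `m` to every member of `𝒮` for the polar form of `F`: cut the complement of `U` into `N`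
chunks of size `m ^ 3` and find a zero-sum subsequence in each. -/
theorem exists_orthogonal_blocks (hm : 2 ≤ m) (hF : IsQuadraticMod m F) {N : ℕ}
    {U : Finset (Fin n)} (hU : U.card + N * m ^ 3 ≤ n) {𝒮 : Finset (Finset (Fin n))}
    (h𝒮 : 𝒮.card ≤ m) (h𝒮U : ∀ S ∈ 𝒮, S ⊆ U) :
    ∃ w : Fin N → Finset (Fin n), (Pairwise fun i j => Disjoint (w i) (w j)) ∧
      ∀ i, (w i).Nonempty ∧ (w i).card ≤ m ^ 3 ∧ Disjoint (w i) U ∧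
        ∀ S ∈ 𝒮, (m : ℤ) ∣ F (S ∪ w i) - F S - F (w i) := by
  classical
  have : NeZero m := ⟨by omega⟩
  have hcard : Fintype.card (Fin N × Fin (m ^ 3)) ≤ Fintype.card {i // i ∈ Uᶜ} := by
    rw [Fintype.card_coe, Finset.card_compl]
    simp only [Fintype.card_prod, Fintype.card_fin]
    omega
  obtain ⟨e⟩ := Function.Embedding.nonempty_of_card_le hcard
  let e' : Fin N × Fin (m ^ 3) ↪ Fin n := e.trans (Function.Embedding.subtype _)
  have he' : ∀ x, e' x ∉ U := fun x => Finset.mem_compl.1 (e x).2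
  let c : Fin N → Fin (m ^ 3) ↪ Fin n := fun i => (Function.Embedding.sectR i _).trans e'
  have hc : ∀ i j, c i j = e' (i, j) := fun i j => rfl
  have hT : ∀ i : Fin N, ∃ T : Finset (Fin (m ^ 3)), T.Nonempty ∧
      ∑ j ∈ T, (fun S : 𝒮 => ((F (S ∪ {c i j}) - F S - F {c i j} : ℤ) : ZMod m)) = 0 := by
    intro i
    refine exists_nonempty_sum_eq_zero (m := m) (by omega) (fun x => ?_) ?_ _
    · ext S; simp
    · rw [Nat.card_eq_fintype_card, Fintype.card_fun, ZMod.card, Fintype.card_coe]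
      exact pow_mul_pred_pow_lt hm h𝒮
  choose T hTne hTsum using hT
  refine ⟨fun i => (T i).map (c i), fun i j hij => ?_, fun i => ⟨by simpa using hTne i, ?_, ?_, ?_⟩⟩
  · simp only [Finset.disjoint_left, Finset.mem_map, not_exists, not_and]
    rintro _ ⟨a, _, rfl⟩ b _ hb
    rw [hc, hc] at hb
    exact hij (Prod.ext_iff.1 (e'.injective hb)).1.symm
  · simpa using Finset.card_le_univ (T i)
  · simp only [Finset.disjoint_left, Finset.mem_map]
    rintro _ ⟨a, _, rfl⟩
    exact he' _
  · intro S hS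
    refine hF.dvd_polar_of_sum S _ ?_ ?_
    · simp only [Finset.disjoint_left, Finset.mem_map]
      rintro _ ⟨a, _, rfl⟩ ha
      exact he' _ (h𝒮U S hS ha)
    · rw [Finset.sum_map, ← ZMod.intCast_zmod_eq_zero_iff_dvd]
      have := congrFun (hTsum i) ⟨S, hS⟩
      rw [Finset.sum_apply] at this
      push_cast at this ⊢
      exact this

/-- If `F` has no nonempty zero modulo `m`, and for no prime `p ∣ m` does it vanish modulo `p` on
a cube spanned by `N` disjoint nonempty blocks, then a family of nonempty sets with distinct values modulo
`m` can be enlarged, as long as enough coordinates remain unused. -/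
theorem exists_larger_family (hm : 2 ≤ m) (hF : IsQuadraticMod m F)
    (hF0 : ∀ S : Finset (Fin n), S.Nonempty → ¬ (m : ℤ) ∣ F S) {N : ℕ}
    (hcube : ∀ p : ℕ, p.Prime → p ∣ m → ∀ w : Fin N → Finset (Fin n),
      (Pairwise fun i j => Disjoint (w i) (w j)) → (∀ i, (w i).Nonempty) →
      ∃ T : Finset (Fin N), ¬ (p : ℤ) ∣ F (T.biUnion w))
    {U : Finset (Fin n)} (hU : U.card + N * m ^ 3 ≤ n) {𝒮 : Finset (Finset (Fin n))}
    (h𝒮 : 𝒮.Nonempty) (h𝒮m : 𝒮.card ≤ m) (h𝒮U : ∀ S ∈ 𝒮, S ⊆ U) (hne : ∀ S ∈ 𝒮, S.Nonempty)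
    (hinj : Set.InjOn (fun S => (F S : ZMod m)) 𝒮) :
    ∃ (U' : Finset (Fin n)) (𝒮' : Finset (Finset (Fin n))), U'.card ≤ U.card + 2 * m ^ 3 ∧
      𝒮'.card = 𝒮.card + 1 ∧ (∀ S ∈ 𝒮', S ⊆ U') ∧ (∀ S ∈ 𝒮', S.Nonempty) ∧
      Set.InjOn (fun S => (F S : ZMod m)) 𝒮' := by
  classical
  have : NeZero m := ⟨by omega⟩
  obtain ⟨p, hp, hpm, hstab⟩ := exists_prime_dvd_of_stabilizes
    (A := 𝒮.image fun S => (F S : ZMod m)) (h𝒮.image _) (by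
      simp only [Finset.mem_image, not_exists, not_and, ZMod.intCast_zmod_eq_zero_iff_dvd]
      exact fun S hS => hF0 S (hne S hS))
  obtain ⟨w, hdisj, hw⟩ := hF.exists_orthogonal_blocks hm hU h𝒮m h𝒮U
  have hwU : ∀ T : Finset (Fin N), Disjoint (T.biUnion w) U := by
    intro T
    rw [Finset.disjoint_biUnion_left]
    exact fun i _ => (hw i).2.2.1
  have horth : ∀ T : Finset (Fin N), ∀ S ∈ 𝒮,
      (m : ℤ) ∣ F (S ∪ T.biUnion w) - F S - F (T.biUnion w) := by
    intro T S hS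
    induction T using Finset.induction_on with
    | empty => simp [hF.map_empty]
    | insert i T hi ih =>
      have hSd : ∀ T : Finset (Fin N), Disjoint S (T.biUnion w) := fun T =>
        ((hwU T).mono_right (h𝒮U S hS)).symm
      have hiT : Disjoint (w i) (T.biUnion w) := by
        simpa using disjoint_biUnion_of_pairwise hdisj (S := {i}) (T := T) (by simpa using hi)
      have h3 := hF.dvd_third_difference S (w i) (T.biUnion w) (by simpa using hSd {i}) (hSd T) hiT
      have := (h3.add ih).add ((hw i).2.2.2 S hS)
      rw [Finset.biUnion_insert, ← Finset.union_assoc]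
      refine this.trans (dvd_of_eq ?_)
      ring
  obtain ⟨T, hT2, hTp⟩ : ∃ T : Finset (Fin N), T.card ≤ 2 ∧ ¬ (p : ℤ) ∣ F (T.biUnion w) := by
    by_contra! h
    obtain ⟨T, hT⟩ := hcube p hp hpm w hdisj fun i => (hw i).1
    exact hT (((hF.of_dvd hpm).comp_biUnion hdisj).dvd_of_card_le_two h T)
  obtain ⟨S, hS, hSnew⟩ : ∃ S ∈ 𝒮, ∀ S' ∈ 𝒮, (F S' : ZMod m) ≠ F S + F (T.biUnion w) := by
    by_contra! h
    refine hTp (hstab _ ?_)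
    simp only [Finset.mem_image, forall_exists_index, and_imp, forall_apply_eq_imp_iff₂]
    exact fun S hS => h S hS
  have hval : (F (S ∪ T.biUnion w) : ZMod m) = F S + F (T.biUnion w) := by
    have := (ZMod.intCast_zmod_eq_zero_iff_dvd _ _).2 (horth T S hS)
    push_cast at this
    linear_combination this
  have hnot : S ∪ T.biUnion w ∉ 𝒮 := fun h => hSnew _ h hval
  refine ⟨U ∪ T.biUnion w, insert (S ∪ T.biUnion w) 𝒮, ?_, Finset.card_insert_of_notMem hnot,
    ?_, ?_, ?_⟩
  · refine (Finset.card_union_le _ _).trans (Nat.add_le_add_left ?_ _)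
    refine (Finset.card_biUnion_le_card_mul _ _ _ fun i _ => (hw i).2.1).trans ?_
    gcongr
  · rw [Finset.forall_mem_insert]
    exact ⟨Finset.union_subset_union_left (h𝒮U S hS),
      fun S' hS' => (h𝒮U S' hS').trans Finset.subset_union_left⟩
  · rw [Finset.forall_mem_insert]
    exact ⟨(hne S hS).mono Finset.subset_union_left, hne⟩
  · rw [Finset.coe_insert, Set.injOn_insert (by simpa using hnot)]
    refine ⟨hinj, ?_⟩
    rintro ⟨S', hS', h⟩
    exact hSnew S' hS' (h.trans hval)

/-- Starting from a single one-element set, the family can be enlarged `m - 1` times if both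
alternatives fail. It then takes all `m` values modulo `m`, the value `0` included. -/
theorem exists_dvd_or_exists_cube (hm : 2 ≤ m) (hF : IsQuadraticMod m F) {N : ℕ}
    (hn : 1 + 2 * m ^ 4 + N * m ^ 3 ≤ n) :
    (∃ S : Finset (Fin n), S.Nonempty ∧ (m : ℤ) ∣ F S) ∨
    ∃ p : ℕ, p.Prime ∧ p ∣ m ∧ ∃ w : Fin N → Finset (Fin n),
      (Pairwise fun i j => Disjoint (w i) (w j)) ∧ (∀ i, (w i).Nonempty) ∧
      ∀ T : Finset (Fin N), (p : ℤ) ∣ F (T.biUnion w) := by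
  by_contra! h
  obtain ⟨hF0, hcube⟩ := h
  have : NeZero m := ⟨by omega⟩
  have key : ∀ k < m, ∃ (U : Finset (Fin n)) (𝒮 : Finset (Finset (Fin n))),
      U.card ≤ 1 + k * (2 * m ^ 3) ∧ 𝒮.card = k + 1 ∧ (∀ S ∈ 𝒮, S ⊆ U) ∧
      (∀ S ∈ 𝒮, S.Nonempty) ∧ Set.InjOn (fun S => (F S : ZMod m)) 𝒮 := by
    intro k
    induction k with
    | zero =>
      intro _
      have i : Fin n := ⟨0, by omega⟩
      exact ⟨{i}, {{i}}, by simp, by simp, by simp, by simp, by simp⟩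
    | succ k ih =>
      intro hk
      obtain ⟨U, 𝒮, hU, hcard, h𝒮U, hne, hinj⟩ := ih (by omega)
      have hkm : k * (2 * m ^ 3) ≤ 2 * m ^ 4 := by
        calc k * (2 * m ^ 3) ≤ m * (2 * m ^ 3) := by gcongr; omega
          _ = 2 * m ^ 4 := by ring
      obtain ⟨U', 𝒮', hU', hcard', h⟩ := hF.exists_larger_family hm hF0 hcube (U := U) (by omega)
        (Finset.card_pos.1 (by omega)) (by omega) h𝒮U hne hinj
      exact ⟨U', 𝒮', by rw [add_mul]; omega, by omega, h⟩
  obtain ⟨U, 𝒮, -, hcard, -, hne, hinj⟩ := key (m - 1) (by omega)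
  have huniv : 𝒮.image (fun S => (F S : ZMod m)) = Finset.univ := by
    rw [← Finset.card_eq_iff_eq_univ, Finset.card_image_of_injOn hinj, ZMod.card]
    omega
  obtain ⟨S, hS, hS0⟩ := Finset.mem_image.1 (huniv ▸ Finset.mem_univ (0 : ZMod m))
  exact hF0 S (hne S hS) ((ZMod.intCast_zmod_eq_zero_iff_dvd _ _).1 hS0)

/-- `M` bounds all the moduli `m`, `m / p`, ... that occur in the induction, which makes the loss of
coordinates uniform: at most a factor `M ^ 6` for each prime factor. -/
theorem exists_nonempty_dvd {M : ℕ} (d : ℕ) {m n : ℕ} (hm : 0 < m) (hmM : m ≤ M)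
    (hd : ArithmeticFunction.cardFactors m = d) (hn : (M ^ 6) ^ d ≤ n)
    {F : Finset (Fin n) → ℤ} (hF : IsQuadraticMod m F) :
    ∃ S : Finset (Fin n), S.Nonempty ∧ (m : ℤ) ∣ F S := by
  induction d generalizing m n with
  | zero =>
    obtain rfl : m = 1 := by
      rcases ArithmeticFunction.cardFactors_eq_zero_iff_eq_zero_or_one.1 hd with h | h <;> omega
    exact ⟨{⟨0, by simpa [Nat.one_le_iff_ne_zero, Nat.pos_iff_ne_zero] using hn⟩}, by simp, by simp⟩
  | succ d ih =>
    have hm2 : 2 ≤ m := by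
      by_contra! h
      obtain rfl : m = 1 := by omega
      simp at hd
    have hsize : 1 + 2 * m ^ 4 + (M ^ 6) ^ d * m ^ 3 ≤ n := by
      have h1 : 1 ≤ (M ^ 6) ^ d := Nat.one_le_pow _ _ (Nat.pow_pos (by omega))
      have h2 : 1 + 2 * m ^ 4 + m ^ 3 ≤ M ^ 6 := by
        refine le_trans ?_ (Nat.pow_le_pow_left hmM 6)
        have h3 : 8 ≤ m ^ 3 := by
          calc 8 = 2 ^ 3 := by norm_num
            _ ≤ m ^ 3 := by gcongr
        have h4 : m ^ 4 = m * m ^ 3 := by ring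
        have h6 : m ^ 6 = m ^ 2 * m ^ 4 := by ring
        have h7 : 2 * m ^ 3 ≤ m * m ^ 3 := by gcongr
        have h8 : 2 ^ 2 * m ^ 4 ≤ m ^ 2 * m ^ 4 := by gcongr
        omega
      calc 1 + 2 * m ^ 4 + (M ^ 6) ^ d * m ^ 3
          ≤ (M ^ 6) ^ d * (1 + 2 * m ^ 4) + (M ^ 6) ^ d * m ^ 3 := by
            gcongr; exact Nat.le_mul_of_pos_left _ h1
        _ = (M ^ 6) ^ d * (1 + 2 * m ^ 4 + m ^ 3) := by ring
        _ ≤ (M ^ 6) ^ d * M ^ 6 := by gcongr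
        _ = (M ^ 6) ^ (d + 1) := by ring
        _ ≤ n := hn
    rcases hF.exists_dvd_or_exists_cube hm2 hsize with h | ⟨p, hp, ⟨q, rfl⟩, w, hdisj, hne, hdvd⟩
    · exact h
    choose G hG using hdvd
    have hq : 0 < q := Nat.pos_of_mul_pos_left hm
    have hGq : IsQuadraticMod q G := by
      refine of_mul hp.pos ?_
      have := hF.comp_biUnion hdisj
      simpa only [hG] using this
    have hdq : ArithmeticFunction.cardFactors q = d := by
      rw [ArithmeticFunction.cardFactors_mul hp.ne_zero hq.ne',
        ArithmeticFunction.cardFactors_apply_prime hp] at hd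
      omega
    obtain ⟨T, ⟨i, hi⟩, hT⟩ := ih hq ((Nat.le_mul_of_pos_left q hp.pos).trans hmM) hdq le_rfl hGq
    refine ⟨T.biUnion w, (hne i).mono (Finset.subset_biUnion_of_mem w hi), ?_⟩
    rw [hG, Nat.cast_mul]
    exact mul_dvd_mul_left _ hT

end IsQuadraticMod

/-! ### Polynomials of degree at most two -/

/-- The value of `f` at the indicator vector of `S`: the sum of the coefficients of the monomials
whose variables all lie in `S`. -/
def finsetEval {m n : ℕ} (f : MvPolynomial (Fin n) (ZMod m)) (S : Finset (Fin n)) : ZMod m :=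
  ∑ s ∈ f.support, if s.support ⊆ S then f.coeff s else 0

theorem boolEval_decide_mem {m n : ℕ} (f : MvPolynomial (Fin n) (ZMod m)) (S : Finset (Fin n)) :
    boolEval f (fun i => decide (i ∈ S)) = finsetEval f S := by
  rw [boolEval, MvPolynomial.eval_eq, finsetEval]
  refine Finset.sum_congr rfl fun s _ => ?_
  split_ifs with h
  · rw [Finset.prod_eq_one, mul_one]
    intro i hi
    simp [h hi]
  · obtain ⟨i, hi, hiS⟩ := Finset.not_subset.1 h
    rw [Finset.prod_eq_zero hi, mul_zero]
    simp [hiS, Finsupp.mem_support_iff.1 hi]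

/-- A monomial in at most two variables has zero third difference along disjoint sets. -/
theorem third_difference_subset_indicator {A ι : Type*} [AddCommGroup A] [DecidableEq ι]
    (c : A) {V R S T : Finset ι} (hV : V.card ≤ 2)
    (hRS : Disjoint R S) (hRT : Disjoint R T) (hST : Disjoint S T) :
    (if V ⊆ R ∪ S ∪ T then c else 0) - (if V ⊆ R ∪ S then c else 0) -
      (if V ⊆ R ∪ T then c else 0) - (if V ⊆ S ∪ T then c else 0) + (if V ⊆ R then c else 0) +
      (if V ⊆ S then c else 0) + (if V ⊆ T then c else 0) - (if V ⊆ ∅ then c else 0) = 0 := by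
  have hRS' := Finset.disjoint_left.1 hRS
  have hRT' := Finset.disjoint_left.1 hRT
  have hST' := Finset.disjoint_left.1 hST
  obtain h | h | h : V.card = 0 ∨ V.card = 1 ∨ V.card = 2 := by omega
  · obtain rfl := Finset.card_eq_zero.1 h
    simp
  · obtain ⟨i, rfl⟩ := Finset.card_eq_one.1 h
    have := @hRS' i
    have := @hRT' i
    have := @hST' i
    by_cases i ∈ R <;> by_cases i ∈ S <;> by_cases i ∈ T <;> simp_all
  · obtain ⟨i, j, -, rfl⟩ := Finset.card_eq_two.1 h
    have := @hRS' i
    have := @hRT' i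
    have := @hST' i
    have := @hRS' j
    have := @hRT' j
    have := @hST' j
    clear hRS' hRT' hST' hRS hRT hST h hV
    by_cases i ∈ R <;> by_cases i ∈ S <;> by_cases i ∈ T <;>
    by_cases j ∈ R <;> by_cases j ∈ S <;> by_cases j ∈ T <;>
      simp_all [Finset.insert_subset_iff]

theorem card_support_le_degree {n : ℕ} (s : Fin n →₀ ℕ) : s.support.card ≤ s.sum fun _ e => e := by
  rw [Finset.card_eq_sum_ones, Finsupp.sum]
  exact Finset.sum_le_sum fun i hi => Nat.one_le_iff_ne_zero.2 (Finsupp.mem_support_iff.1 hi)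

/-- The cast from `ZMod m` to `ℤ` picks arbitrary representatives; only their classes matter, apart
from the value `0` at `∅`. -/
theorem isQuadraticMod_cast_finsetEval {m n : ℕ} (f : MvPolynomial (Fin n) (ZMod m))
    (hf : f.totalDegree ≤ 2) :
    IsQuadraticMod m fun S => ((finsetEval f S - finsetEval f ∅).cast : ℤ) := by
  refine ⟨by simp, fun R S T h₁ h₂ h₃ => ?_⟩
  rw [← ZMod.intCast_zmod_eq_zero_iff_dvd]
  push_cast
  have : finsetEval f (R ∪ S ∪ T) - finsetEval f (R ∪ S) - finsetEval f (R ∪ T) -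
      finsetEval f (S ∪ T) + finsetEval f R + finsetEval f S + finsetEval f T -
      finsetEval f ∅ = 0 := by
    simp only [finsetEval, ← Finset.sum_sub_distrib, ← Finset.sum_add_distrib]
    refine Finset.sum_eq_zero fun s hs => third_difference_subset_indicator _ ?_ h₁ h₂ h₃
    exact (card_support_le_degree s).trans ((MvPolynomial.le_totalDegree hs).trans hf)
  linear_combination this

theorem theorem1p1 :
    ∃ C : ℝ, 0 < C ∧
      ∀ (m d n : ℕ), 0 < m → ArithmeticFunction.cardFactors m = d →
        ∀ f : MvPolynomial (Fin n) (ZMod m), f.totalDegree ≤ 2 →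
          WeaklyRepresents (boolEval f) (orFn n) →
            (n : ℝ) ≤ (m : ℝ) ^ (C * (d : ℝ)) ∧
              (m : ℝ) ^ (C * (d : ℝ)) ≤ (m : ℝ) ^ (C * Real.logb 2 (m : ℝ)) := by
  refine ⟨6, by norm_num, fun m d n hm hd f hf ⟨A, hA⟩ => ⟨?_, ?_⟩⟩
  · have hlt : n ≤ m ^ (6 * d) := by
      by_contra! hn
      obtain ⟨S, ⟨i, hi⟩, hS⟩ := (isQuadraticMod_cast_finsetEval f hf).exists_nonempty_dvd d hm
        le_rfl hd (by rw [← pow_mul]; exact hn.le)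
      have hval : finsetEval f S = finsetEval f ∅ := by
        rw [← ZMod.intCast_zmod_eq_zero_iff_dvd, ZMod.intCast_cast, ZMod.cast_id', id_eq] at hS
        exact sub_eq_zero.1 hS
      have h0 : finsetEval f ∅ ∈ A := by
        rw [← boolEval_decide_mem, ← (hA _).1]
        simp [orFn]
      rw [← hval, ← boolEval_decide_mem, ← (hA _).1] at h0
      have := congrFun (by simpa [orFn] using h0 : (fun i => decide (i ∈ S)) = fun _ => false) i
      simp [hi] at this
    have hcast : (m : ℝ) ^ (6 * (d : ℝ)) = ((m ^ (6 * d) : ℕ) : ℝ) := by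
      rw [Nat.cast_pow, ← Real.rpow_natCast]
      push_cast
      rfl
    rw [hcast]
    exact_mod_cast hlt
  · have h2 : 2 ^ d ≤ m := by
      rw [← hd, ArithmeticFunction.cardFactors_apply]
      conv_rhs => rw [← Nat.prod_primeFactorsList hm.ne']
      exact List.pow_card_le_prod _ _ fun p hp => (Nat.prime_of_mem_primeFactorsList hp).two_le
    have hlog : (d : ℝ) ≤ Real.logb 2 m := by
      rw [Real.le_logb_iff_rpow_le (by norm_num) (by exact_mod_cast hm), Real.rpow_natCast]
      exact_mod_cast h2
    exact Real.rpow_le_rpow_of_exponent_le (by exact_mod_cast hm) (by gcongr)
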